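/- All matroids and lattices are finite. For a matroid $M$ with rank function $r$, a flat $X$ of $M$ is \emph{cyclic} if the restriction $M|X$ has no isthmuses (coloops). Ordered by inclusion, the cyclic flats of $M$ form a lattice $\mathcal{Z}(M)$. An \emph{MI-ordering} of an antichain $\mathcal{A}$ in a lattice $L$ is a listing $a_1,a_2,\ldots,a_t$ of the elements of $\mathcal{A}$, each exactly once, such that (a) $a_i\lor a_{i+1}\lor\cdots\lor a_k=a_i\lor a_k$ for $1\le i<k\le t$, and (b) $(a_1\land a_2\land\cdots\land a_k)\lor a_{k+1}=a_k\lor a_{k+1}$ for $1<k<t$. An antichain is \emph{MI-orderable} if it has an MI-ordering; a lattice is \emph{MI-orderable}, or an \emph{MI-lattice}, if each of its antichains is MI-orderable. A matroid is \emph{transversal} if its independent sets are exactly the partial transversals of some finite family of subsets of its ground set. A lattice $L$ is a \emph{Tr-lattice} if every matroid $M$ with $\mathcal{Z}(M)\cong L$ is transversal. \textbf{Theorem.} Let $M$ be a matroid. (i) Every nonempty MI-orderable antichain $\mathcal{A}$ in $\mathcal{Z}(M)$ satisfies the Mason--Ingleton inequality $$r\Bigl(\bigcap_{X\in\mathcal{A}}X\Bigr)\le\sum_{\mathcal{F}\subseteq\mathcal{A}}(-1)^{|\mathcal{F}|+1}\,r\Bigl(\bigcup_{X\in\mathcal{F}}X\Bigr).$$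 (ii) If $\mathcal{Z}(M)$ is MI-orderable, then $M$ and all of its minors are transversal. Consequently, every MI-lattice is a Tr-lattice. -/

import Mathlib

universe u v

open Set
open scoped Matroid

/-! ### Cyclic flats and their lattice -/

/-- `F` is a cyclic flat of `M`: a flat such that the restriction of `M` to `F` has no isthmuses
(coloops). -/
def Matroid.IsCyclicFlat {α : Type u} (M : Matroid α) (F : Set α) : Prop :=
  M.IsFlat F ∧ ∀ e, ¬ (M ↾ F).IsColoop e

/-- A flat is cyclic if and only if each of its elements lies in a circuit inside it. -/
theorem Matroid.isCyclicFlat_iff {α : Type u} (M : Matroid α) (F : Set α) :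
    M.IsCyclicFlat F ↔ M.IsFlat F ∧ ∀ e ∈ F, ∃ C, M.IsCircuit C ∧ C ⊆ F ∧ e ∈ C := by
  refine and_congr_right fun hF ↦ ⟨fun h e he ↦ ?_, fun h e he ↦ ?_⟩
  · have h1 := h e
    rw [Matroid.isColoop_iff_forall_notMem_isCircuit (M := M ↾ F) he] at h1
    push Not at h1
    obtain ⟨C, hC, heC⟩ := h1
    rw [Matroid.restrict_isCircuit_iff hF.subset_ground] at hC
    exact ⟨C, hC.1, hC.2, heC⟩
  · obtain ⟨C, hC, hCF, heC⟩ := h e he.mem_ground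
    exact he.notMem_isCircuit
      ((Matroid.restrict_isCircuit_iff hF.subset_ground).2 ⟨hC, hCF⟩) heC

/-- The cyclic flats of `M`, ordered by inclusion. -/
abbrev Matroid.CyclicFlats {α : Type u} (M : Matroid α) : Type u :=
  {F : Set α // M.IsCyclicFlat F}

/-- The union of the circuits of `M` that are contained in `X`. -/
def Matroid.circuitUnion {α : Type u} (M : Matroid α) (X : Set α) : Set α :=
  ⋃₀ {C | M.IsCircuit C ∧ C ⊆ X}

theorem Matroid.circuitUnion_subset {α : Type u} (M : Matroid α) (X : Set α) :
    M.circuitUnion X ⊆ X :=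
  sUnion_subset fun _ hC ↦ hC.2

theorem Matroid.IsCyclicFlat.closure_union {α : Type u} {M : Matroid α} {A B : Set α}
    (hA : M.IsCyclicFlat A) (hB : M.IsCyclicFlat B) : M.IsCyclicFlat (M.closure (A ∪ B)) := by
  rw [Matroid.isCyclicFlat_iff] at *
  have hss : A ∪ B ⊆ M.closure (A ∪ B) :=
    M.subset_closure _ (union_subset hA.1.subset_ground hB.1.subset_ground)
  refine ⟨Matroid.isFlat_closure _, fun e he ↦ ?_⟩
  by_cases heAB : e ∈ A ∪ B
  · obtain h | h := heAB
    · obtain ⟨C, hC, hCA, heC⟩ := hA.2 e h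
      exact ⟨C, hC, (hCA.trans subset_union_left).trans hss, heC⟩
    · obtain ⟨C, hC, hCB, heC⟩ := hB.2 e h
      exact ⟨C, hC, (hCB.trans subset_union_right).trans hss, heC⟩
  · obtain ⟨C, hCs, hC, heC⟩ := Matroid.exists_isCircuit_of_mem_closure he heAB
    exact ⟨C, hC, hCs.trans (insert_subset he hss), heC⟩

theorem Matroid.IsCyclicFlat.circuitUnion_inter {α : Type u} {M : Matroid α} {A B : Set α}
    (hA : M.IsCyclicFlat A) (hB : M.IsCyclicFlat B) :
    M.IsCyclicFlat (M.circuitUnion (A ∩ B)) := by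
  rw [Matroid.isCyclicFlat_iff] at *
  have hss := M.circuitUnion_subset (A ∩ B)
  have hE : M.circuitUnion (A ∩ B) ⊆ M.E :=
    hss.trans (inter_subset_left.trans hA.1.subset_ground)
  refine ⟨?_, fun e he ↦ ?_⟩
  · rw [Matroid.isFlat_iff_closure_eq]
    refine Subset.antisymm (fun e he ↦ ?_) (M.subset_closure _ hE)
    by_contra hne
    obtain ⟨C, hCs, hC, heC⟩ := Matroid.exists_isCircuit_of_mem_closure he hne
    have heA : e ∈ A := by
      rw [← hA.1.closure]
      exact M.closure_subset_closure (hss.trans inter_subset_left) he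
    have heB : e ∈ B := by
      rw [← hB.1.closure]
      exact M.closure_subset_closure (hss.trans inter_subset_right) he
    exact hne ⟨C, ⟨hC, hCs.trans (insert_subset ⟨heA, heB⟩ hss)⟩, heC⟩
  · obtain ⟨C, hC, heC⟩ := he
    exact ⟨C, hC.1, subset_sUnion_of_mem hC, heC⟩

/-- The lattice `𝒵(M)` of cyclic flats under inclusion. The join of `A` and `B` is the closure of
`A ∪ B`, and their meet is the union of the circuits contained in `A ∩ B`. -/
instance Matroid.CyclicFlats.instLattice {α : Type u} (M : Matroid α) :
    Lattice M.CyclicFlats :=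
  { (inferInstance : PartialOrder M.CyclicFlats) with
    sup := fun A B ↦ ⟨M.closure (A.1 ∪ B.1), A.2.closure_union B.2⟩
    le_sup_left := fun A B ↦ subset_union_left.trans
      (M.subset_closure _ (union_subset A.2.1.subset_ground B.2.1.subset_ground))
    le_sup_right := fun A B ↦ subset_union_right.trans
      (M.subset_closure _ (union_subset A.2.1.subset_ground B.2.1.subset_ground))
    sup_le := fun A B C hAC hBC ↦ by
      have h : M.closure (A.1 ∪ B.1) ⊆ M.closure C.1 :=
        M.closure_subset_closure (union_subset hAC hBC)
      rw [C.2.1.closure] at h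
      exact h
    inf := fun A B ↦ ⟨M.circuitUnion (A.1 ∩ B.1), A.2.circuitUnion_inter B.2⟩
    inf_le_left := fun A B ↦ (M.circuitUnion_subset _).trans inter_subset_left
    inf_le_right := fun A B ↦ (M.circuitUnion_subset _).trans inter_subset_right
    le_inf := fun A B C hAB hAC e he ↦ by
      obtain ⟨D, hD, hDA, heD⟩ := ((M.isCyclicFlat_iff A.1).1 A.2).2 e he
      exact ⟨D, ⟨hD, subset_inter (hDA.trans hAB) (hDA.trans hAC)⟩, heD⟩ }

/-! ### Orderings of antichains -/

/-- `a 0, …, a (t - 1)` is an MI-ordering of its set of values: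
`a i ⊔ a (i + 1) ⊔ ⋯ ⊔ a k = a i ⊔ a k` whenever `i < k`, and
`(a 0 ⊓ ⋯ ⊓ a k) ⊔ a (k + 1) = a k ⊔ a (k + 1)` whenever `0 < k` and `k + 1 < t`. -/
structure IsMIOrdering {L : Type v} [Lattice L] {t : ℕ} (a : Fin t → L) : Prop where
  sup_interval : ∀ (i k : Fin t) (h : i < k),
    (Finset.Icc i k).sup' (Finset.nonempty_Icc.2 h.le) a = a i ⊔ a k
  inf_initial : ∀ k l : Fin t, 0 < (k : ℕ) → (l : ℕ) = (k : ℕ) + 1 →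
    (Finset.Iic k).inf' Finset.nonempty_Iic a ⊔ a l = a k ⊔ a l

/-- The elements of `A` can be listed, each exactly once, in an MI-ordering. -/
def IsMIOrderable {L : Type v} [Lattice L] (A : Finset L) : Prop :=
  ∃ (t : ℕ) (a : Fin t → L),
    Function.Injective a ∧ Set.range a = (A : Set L) ∧ IsMIOrdering a

/-- An MI-orderable (finite) lattice, or MI-lattice: each antichain is MI-orderable. -/
def IsMILattice (L : Type v) [Lattice L] : Prop :=
  ∀ A : Finset L, IsAntichain (· ≤ ·) (A : Set L) → IsMIOrderable A

/-! ### The Mason–Ingleton inequality and transversal matroids -/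

/-- The integer-valued rank of a set; used for finite matroids, where all ranks are finite. -/
noncomputable def Matroid.intRank {α : Type u} (M : Matroid α) (X : Set α) : ℤ :=
  ((M.eRk X).toNat : ℤ)

/-- The Mason–Ingleton inequality for a (nonempty) collection `A` of cyclic flats. -/
def Matroid.SatisfiesMI {α : Type u} (M : Matroid α) (A : Finset M.CyclicFlats) : Prop :=
  M.intRank (⋂ X ∈ A, (X : Set α)) ≤
    ∑ F ∈ A.powerset, (-1 : ℤ) ^ (F.card + 1) * M.intRank (⋃ X ∈ F, (X : Set α))

/-- `I` is a partial transversal of `S`: there is an injection `f` from `I` to the index set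
with `e ∈ S (f e)` for all `e ∈ I`. -/
def IsPartialTransversal {α : Type u} {n : ℕ} (S : Fin n → Set α) (I : Set α) : Prop :=
  ∃ f : I → Fin n, Function.Injective f ∧ ∀ e : I, (e : α) ∈ S (f e)

/-- `M` is transversal: its independent sets are the partial transversals of a finite family of
subsets of its ground set. -/
def Matroid.IsTransversal {α : Type u} (M : Matroid α) : Prop :=
  ∃ (n : ℕ) (S : Fin n → Set α),
    (∀ j, S j ⊆ M.E) ∧ ∀ I : Set α, M.Indep I ↔ IsPartialTransversal S I

/-- A Tr-lattice: every (finite) matroid whose lattice of cyclic flats is isomorphic to `L` is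
transversal. -/
def IsTrLattice (L : Type v) [Lattice L] : Prop :=
  ∀ (α : Type u) (M : Matroid α), M.Finite → Nonempty (M.CyclicFlats ≃o L) → M.IsTransversal

/-! ### Orderings and Galois insertions -/

/-! For (i), induct on the length of the MI-ordering. When `a (k + 1)` is appended, condition (a)
makes adding `a k` to any nonempty set of earlier terms, with `a (k + 1)` present, irrelevant to the
closure of the union. The new terms of the alternating sum therefore cancel in pairs down to `r(a (k
+ 1)) - r(a k ∪ a (k + 1))`. Condition (b) bounds the second rank by that of the old intersection
together with `a (k + 1)`, and submodularity concludes (`Matroid.intRank_biInter_le_of_ordering`).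

For (ii), Möbius inversion on `𝒵(M)` gives `β` whose sum over the cyclic flats above `X` is the
corank of `X`. By inclusion–exclusion, the Mason–Ingleton inequalities bound the sums of `β` over
all filters (`Matroid.sum_filter_le_corank`). So `β ≥ 0`, and taking `β Y` copies of each `M.E \ Y`
presents `M`: Hall's condition is the filter bound, while a circuit meets too few members to be
matched.

For minors, `𝒵(M ／ X)` is the image of `𝒵(M)` under a Galois insertion, and MI-lattices pass along
such maps. Deletion needs no lattice argument, since transversality itself survives it. -/

theorem IsMIOrdering.le_sup {L : Type v} [Lattice L] {t : ℕ} {a : Fin t → L}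
    (ha : IsMIOrdering a) {i j k : Fin t} (hij : i ≤ j) (hjk : j ≤ k) : a j ≤ a i ⊔ a k := by
  rcases (hij.trans hjk).lt_or_eq with h | rfl
  · rw [← ha.sup_interval i k h]
    exact Finset.le_sup' a (Finset.mem_Icc.2 ⟨hij, hjk⟩)
  · rw [le_antisymm hjk hij]
    exact le_sup_left

/-- An order-theoretic form of the definition of an MI-ordering. -/
theorem isMIOrdering_iff {L : Type v} [Lattice L] {t : ℕ} {a : Fin t → L} :
    IsMIOrdering a ↔ (∀ i j k : Fin t, i ≤ j → j ≤ k → a j ≤ a i ⊔ a k) ∧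
      ∀ k l : Fin t, 0 < (k : ℕ) → (l : ℕ) = (k : ℕ) + 1 →
        a k ≤ (Finset.Iic k).inf' Finset.nonempty_Iic a ⊔ a l := by
  refine ⟨fun h ↦ ⟨fun i j k ↦ h.le_sup, fun k l hk hl ↦ ?_⟩, fun h ↦ ⟨fun i k hik ↦ ?_,
    fun k l hk hl ↦ ?_⟩⟩
  · rw [h.inf_initial k l hk hl]
    exact le_sup_left
  · refine le_antisymm (Finset.sup'_le _ _ fun j hj ↦ ?_) (sup_le ?_ ?_)
    · exact h.1 i j k (Finset.mem_Icc.1 hj).1 (Finset.mem_Icc.1 hj).2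
    · exact Finset.le_sup' a (Finset.mem_Icc.2 ⟨le_rfl, hik.le⟩)
    · exact Finset.le_sup' a (Finset.mem_Icc.2 ⟨hik.le, le_rfl⟩)
  · refine le_antisymm (sup_le_sup_right (Finset.inf'_le a (Finset.mem_Iic.2 le_rfl)) _)
      (sup_le (h.2 k l hk hl) le_sup_right)

/-- MI-orderings of `u ∘ a` descend to MI-orderings of `a` along a Galois insertion. -/
theorem GaloisInsertion.isMIOrdering {L : Type v} {L' : Type u} [Lattice L] [Lattice L']
    {l : L → L'} {r : L' → L} (gi : GaloisInsertion l r) {t : ℕ} {a : Fin t → L'}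
    (h : IsMIOrdering (r ∘ a)) : IsMIOrdering a := by
  rw [isMIOrdering_iff] at h ⊢
  refine ⟨fun i j k hij hjk ↦ ?_, fun k m hk hm ↦ ?_⟩
  · have := gi.gc.monotone_l (h.1 i j k hij hjk)
    simpa [gi.gc.l_sup, gi.l_u_eq] using this
  · refine (gi.le_l_u _).trans ((gi.gc.monotone_l (h.2 k m hk hm)).trans ?_)
    rw [gi.gc.l_sup]
    -- A left adjoint need not preserve meets; the inequality `l (⨅ r (a i)) ≤ ⨅ a i` is enough
    -- here.
    exact sup_le_sup (Finset.le_inf' _ _ fun i hi ↦ gi.gc.l_le (Finset.inf'_le (r ∘ a) hi))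
      (gi.l_u_eq _).le

/-- The section `r` reflects order, so it carries antichains to antichains, and an ordering of the
image can be pulled back. This serves both contractions and lattice isomorphisms. -/
theorem IsMILattice.of_galoisInsertion {L : Type v} {L' : Type u} [Lattice L] [Lattice L']
    {l : L → L'} {r : L' → L} (gi : GaloisInsertion l r) (h : IsMILattice L) :
    IsMILattice L' := by
  classical
  intro A hA
  have hr : ∀ x y, r x ≤ r y → x ≤ y := fun x y hxy ↦ gi.u_le_u_iff.1 hxy
  obtain ⟨t, b, hb, hbr, hMI⟩ := h (A.image r) (by
    rw [Finset.coe_image]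
    rintro _ ⟨x, hx, rfl⟩ _ ⟨y, hy, rfl⟩ hne hle
    exact hA hx hy (fun h ↦ hne (congrArg r h)) (hr _ _ hle))
  have hmem : ∀ i, b i ∈ r '' (A : Set L') := fun i ↦ by
    rw [← Finset.coe_image, ← hbr]
    exact mem_range_self i
  choose a haA hab using hmem
  have hba : r ∘ a = b := funext hab
  refine ⟨t, a, fun i j hij ↦ hb (by rw [← hab, ← hab, hij]), Subset.antisymm ?_ fun x hx ↦ ?_,
    gi.isMIOrdering (hba ▸ hMI)⟩
  · rintro _ ⟨i, rfl⟩
    exact haA i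
  · have : r x ∈ range b := by
      rw [hbr, Finset.coe_image]
      exact mem_image_of_mem r hx
    obtain ⟨i, hi⟩ := this
    exact ⟨i, gi.u_injective ((hab i).trans hi)⟩

/-! ### Transversal presentations -/

/-- A presentation may be indexed by any finite type. -/
theorem Matroid.IsTransversal.of_fintype {α : Type u} {M : Matroid α} {ι : Type*} [Fintype ι]
    (S : ι → Set α) (hS : ∀ j, S j ⊆ M.E)
    (h : ∀ I : Set α, M.Indep I ↔
      ∃ f : I → ι, Function.Injective f ∧ ∀ e : I, (e : α) ∈ S (f e)) : M.IsTransversal := by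
  let φ := Fintype.equivFin ι
  refine ⟨Fintype.card ι, fun j ↦ S (φ.symm j), fun j ↦ hS _, fun I ↦ (h I).trans ⟨?_, ?_⟩⟩
  · rintro ⟨f, hf, hfS⟩
    exact ⟨φ ∘ f, φ.injective.comp hf, fun e ↦ by simpa using hfS e⟩
  · rintro ⟨f, hf, hfS⟩
    exact ⟨φ.symm ∘ f, φ.symm.injective.comp hf, hfS⟩

theorem Matroid.IsTransversal.delete {α : Type u} {M : Matroid α} (h : M.IsTransversal)
    (D : Set α) : (M ＼ D).IsTransversal := by
  obtain ⟨n, S, hS, hI⟩ := h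
  refine ⟨n, fun j ↦ S j \ D, fun j ↦ ?_, fun I ↦ ?_⟩
  · rw [Matroid.delete_ground]
    exact sdiff_subset_sdiff_left (hS j)
  · rw [Matroid.delete_indep_iff, hI]
    constructor
    · rintro ⟨⟨f, hf, hfS⟩, hd⟩
      exact ⟨f, hf, fun e ↦ ⟨hfS e, hd.notMem_of_mem_left e.2⟩⟩
    · rintro ⟨f, hf, hfS⟩
      exact ⟨⟨f, hf, fun e ↦ (hfS e).1⟩, Set.disjoint_left.2 fun e he ↦ (hfS ⟨e, he⟩).2⟩

/-! ### Cyclic flats -/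

/-- The closure form of cyclicity is convenient for contractions, whose closure operator is
explicit. -/
theorem Matroid.isCyclicFlat_iff_mem_closure {α : Type u} (M : Matroid α) (F : Set α) :
    M.IsCyclicFlat F ↔ M.IsFlat F ∧ ∀ e ∈ F, e ∈ M.closure (F \ {e}) := by
  rw [Matroid.isCyclicFlat_iff]
  refine and_congr_right fun hF ↦ forall₂_congr fun e he ↦ ⟨?_, fun h ↦ ?_⟩
  · rintro ⟨C, hC, hCF, heC⟩
    exact M.closure_subset_closure (sdiff_subset_sdiff_left hCF)
      (hC.mem_closure_sdiff_singleton_of_mem heC)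
  · obtain ⟨C, hCs, hC, heC⟩ := Matroid.exists_isCircuit_of_mem_closure h (by simp)
    exact ⟨C, hC, hCs.trans (insert_subset he sdiff_subset), heC⟩

theorem Matroid.IsFlat.closure_subset_iff_subset {α : Type u} {M : Matroid α} {F X : Set α}
    (hF : M.IsFlat F) (hX : X ⊆ M.E) : M.closure X ⊆ F ↔ X ⊆ F := by
  conv_rhs => rw [← hF.closure, ← M.closure_subset_closure_iff_subset_closure hX, hF.closure]

theorem Matroid.isCyclicFlat_closure {α : Type u} {M : Matroid α} {X : Set α}
    (hX : ∀ e ∈ X, e ∈ M.closure (X \ {e})) : M.IsCyclicFlat (M.closure X) := by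
  have hXE : X ⊆ M.E := fun e he ↦ M.closure_subset_ground _ (hX e he)
  rw [Matroid.isCyclicFlat_iff_mem_closure]
  refine ⟨M.isFlat_closure X, fun e he ↦ ?_⟩
  by_cases heX : e ∈ X
  · exact M.closure_subset_closure (sdiff_subset_sdiff_left (M.subset_closure X hXE)) (hX e heX)
  · exact M.closure_subset_closure (subset_sdiff_singleton (M.subset_closure X hXE) heX) he

theorem Matroid.isCyclicFlat_closure_biUnion {α : Type u} {M : Matroid α}
    (A : Finset M.CyclicFlats) : M.IsCyclicFlat (M.closure (⋃ X ∈ A, (X : Set α))) := by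
  refine Matroid.isCyclicFlat_closure fun e he ↦ ?_
  simp only [mem_iUnion] at he
  obtain ⟨X, hX, he⟩ := he
  exact M.closure_subset_closure
    (sdiff_subset_sdiff_left (subset_biUnion_of_mem (u := fun X : M.CyclicFlats ↦ (X : Set α)) hX))
    (((M.isCyclicFlat_iff_mem_closure _).1 X.2).2 e he)

theorem Matroid.biUnion_cyclicFlats_subset_ground {α : Type u} {M : Matroid α}
    (A : Finset M.CyclicFlats) : (⋃ X ∈ A, (X : Set α)) ⊆ M.E :=
  iUnion₂_subset fun X _ ↦ X.2.1.subset_ground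

/-- A circuit that adds one element to the union stays inside the flat, so it was already counted.
This provides the adjoint section for contractions. -/
theorem Matroid.IsFlat.circuitUnion {α : Type u} {M : Matroid α} {F : Set α} (hF : M.IsFlat F) :
    M.IsCyclicFlat (M.circuitUnion F) := by
  have hss := M.circuitUnion_subset F
  rw [Matroid.isCyclicFlat_iff, Matroid.isFlat_iff_closure_eq]
  refine ⟨Subset.antisymm (fun e he ↦ ?_) (M.subset_closure _ (hss.trans hF.subset_ground)), ?_⟩
  · by_contra hne
    obtain ⟨C, hCs, hC, heC⟩ := Matroid.exists_isCircuit_of_mem_closure he hne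
    have heF : e ∈ F := by
      rw [← hF.closure]
      exact M.closure_subset_closure hss he
    exact hne ⟨C, ⟨hC, hCs.trans (insert_subset heF hss)⟩, heC⟩
  · rintro e ⟨C, hC, heC⟩
    exact ⟨C, hC.1, subset_sUnion_of_mem hC, heC⟩

theorem Matroid.IsCyclicFlat.subset_circuitUnion_iff {α : Type u} {M : Matroid α} {F X : Set α}
    (hF : M.IsCyclicFlat F) : F ⊆ M.circuitUnion X ↔ F ⊆ X := by
  refine ⟨fun h ↦ h.trans (M.circuitUnion_subset X), fun h e he ↦ ?_⟩
  obtain ⟨C, hC, hCF, heC⟩ := ((M.isCyclicFlat_iff F).1 hF).2 e he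
  exact ⟨C, ⟨hC, hCF.trans h⟩, heC⟩

/-! ### Cyclic flats of contractions -/

/-- An element of `F` is spanned by the rest of `F`; any other element of the new closure is spanned
by `F ∪ X`, which avoids it. -/
theorem Matroid.IsCyclicFlat.contract_closure {α : Type u} {M : Matroid α} {F : Set α}
    (hF : M.IsCyclicFlat F) (X : Set α) : (M ／ X).IsCyclicFlat ((M ／ X).closure F) := by
  rw [Matroid.isCyclicFlat_iff_mem_closure] at hF ⊢
  refine ⟨Matroid.isFlat_closure _, fun e he ↦ ?_⟩
  have hFE := hF.1.subset_ground
  rw [Matroid.contract_closure_eq] at he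
  rw [Matroid.contract_closure_eq, Matroid.contract_closure_eq]
  have hsub : F ⊆ M.closure (F ∪ X) \ X ∪ X := by
    rw [sdiff_union_self]
    exact fun x hx ↦ Or.inl (M.mem_closure_of_mem' (Or.inl hx) (hFE hx))
  refine ⟨?_, he.2⟩
  by_cases heF : e ∈ F
  · refine M.closure_subset_closure (fun x hx ↦ ?_) (hF.2 e heF)
    exact (hsub hx.1).imp (fun h ↦ ⟨h, hx.2⟩) id
  · refine M.closure_subset_closure (union_subset (fun x hx ↦ ?_) subset_union_right) he.1
    exact (hsub hx).imp (fun h ↦ ⟨h, fun hxe ↦ heF (hxe ▸ hx)⟩) id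

theorem Matroid.IsFlat.union_contract {α : Type u} {M : Matroid α} {F X : Set α} (hX : X ⊆ M.E)
    (hF : (M ／ X).IsFlat F) : M.IsFlat (F ∪ X) := by
  have h := hF.closure
  rw [Matroid.contract_closure_eq] at h
  have hFE : F ∪ X ⊆ M.E := union_subset (h ▸ sdiff_subset.trans (M.closure_subset_ground _)) hX
  rw [Matroid.isFlat_iff_closure_eq]
  conv_rhs => rw [← h]
  rw [sdiff_union_of_subset (subset_union_right.trans (M.subset_closure _ hFE))]

/-- Taking closures in `M ／ X` maps `𝒵(M)` onto `𝒵(M ／ X)`; the adjoint section sends `F` to the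
union of the circuits in `F ∪ X`. -/
noncomputable def Matroid.contractGaloisInsertion {α : Type u} (M : Matroid α) {X : Set α}
    (hX : X ⊆ M.E) :
    GaloisInsertion
      (fun F : M.CyclicFlats ↦ (⟨_, F.2.contract_closure X⟩ : (M ／ X).CyclicFlats))
      (fun F ↦ (⟨_, (F.2.1.union_contract hX).circuitUnion⟩ : M.CyclicFlats)) :=
  GaloisConnection.toGaloisInsertion
    (fun F G ↦ by
      have hFE := F.2.1.subset_ground
      have hG : M.closure (G.1 ∪ X) \ X = G.1 := by
        rw [← Matroid.contract_closure_eq, G.2.1.closure]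
      change (M ／ X).closure F.1 ⊆ G.1 ↔ F.1 ⊆ M.circuitUnion (G.1 ∪ X)
      rw [F.2.subset_circuitUnion_iff, Matroid.contract_closure_eq]
      refine ⟨fun h x hx ↦ ?_, fun h ↦ ?_⟩
      · by_cases hxX : x ∈ X
        · exact Or.inr hxX
        · exact Or.inl (h ⟨M.mem_closure_of_mem' (Or.inl hx) (hFE hx), hxX⟩)
      · rw [← hG]
        refine sdiff_subset_sdiff_left (M.closure_subset_closure ?_)
        exact union_subset h subset_union_right)
    (fun G e he ↦ by
      have h := ((Matroid.isCyclicFlat_iff_mem_closure _ _).1 G.2).2 e he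
      rw [Matroid.contract_closure_eq] at h
      change e ∈ (M ／ X).closure (M.circuitUnion (G.1 ∪ X))
      rw [Matroid.contract_closure_eq]
      refine ⟨?_, h.2⟩
      -- As `e ∉ X`, cyclicity in `M ／ X` yields a circuit of `M` through `e` inside `G ∪ X`.
      obtain ⟨C, hCs, hC, heC⟩ := Matroid.exists_isCircuit_of_mem_closure h.1
        (by simp [h.2])
      refine M.mem_closure_of_mem' (Or.inl ⟨C, ⟨hC, hCs.trans ?_⟩, heC⟩) (hC.subset_ground heC)
      exact insert_subset (Or.inl he) (union_subset_union_left _ sdiff_subset))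


/-! ### Integer ranks -/

section IntRank

variable {α : Type u} {M : Matroid α} {X Y : Set α}

theorem Matroid.coe_toNat_eRk (M : Matroid α) [M.RankFinite] (X : Set α) :
    ((M.eRk X).toNat : ℕ∞) = M.eRk X :=
  ENat.natCast_toNat (M.isRkFinite_set X).eRk_lt_top.ne

theorem Matroid.intRank_mono [M.RankFinite] (h : X ⊆ Y) : M.intRank X ≤ M.intRank Y :=
  Int.ofNat_le.2 (ENat.toNat_le_toNat (M.eRk_mono h) (M.isRkFinite_set Y).eRk_lt_top.ne)

theorem Matroid.intRank_closure (M : Matroid α) (X : Set α) :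
    M.intRank (M.closure X) = M.intRank X := by
  rw [Matroid.intRank, Matroid.eRk_closure_eq, Matroid.intRank]

theorem Matroid.intRank_empty (M : Matroid α) : M.intRank ∅ = 0 := by
  rw [Matroid.intRank, Matroid.eRk_empty, ENat.toNat_zero, Nat.cast_zero]

theorem Matroid.intRank_le_ground (M : Matroid α) [M.RankFinite] (X : Set α) :
    M.intRank X ≤ M.intRank M.E := by
  rw [← M.intRank_closure X]
  exact Matroid.intRank_mono (M.closure_subset_ground X)

theorem Matroid.intRank_inter_add_intRank_union_le (M : Matroid α) [M.RankFinite] (X Y : Set α) :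
    M.intRank (X ∩ Y) + M.intRank (X ∪ Y) ≤ M.intRank X + M.intRank Y := by
  have h := M.eRk_inter_add_eRk_union_le X Y
  rw [← M.coe_toNat_eRk (X ∩ Y), ← M.coe_toNat_eRk (X ∪ Y), ← M.coe_toNat_eRk X,
    ← M.coe_toNat_eRk Y] at h
  rw [Matroid.intRank, Matroid.intRank, Matroid.intRank, Matroid.intRank]
  exact_mod_cast h

theorem Matroid.Indep.intRank_eq {J : Finset α} (hJ : M.Indep (J : Set α)) :
    M.intRank (J : Set α) = J.card := by
  rw [Matroid.intRank, hJ.eRk_eq_encard, Set.encard_coe_eq_coe_finsetCard, ENat.toNat_natCast]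

theorem Matroid.IsCircuit.intRank_add_one {C : Finset α} (hC : M.IsCircuit (C : Set α)) :
    M.intRank (C : Set α) + 1 = C.card := by
  have h := hC.eRk_add_one_eq
  rw [Set.encard_coe_eq_coe_finsetCard] at h
  have hne : M.eRk (C : Set α) ≠ ⊤ := by
    intro h'
    simp [h'] at h
  rw [← ENat.natCast_toNat hne] at h
  rw [Matroid.intRank]
  exact_mod_cast h

/-! ### The Mason–Ingleton inequality for MI-orderable antichains -/

/-- An alternating sum over all subsets, in which toggling `k` cancels all nonempty sets. -/
theorem Finset.sum_powerset_range_alternating (g : Finset ℕ → ℤ) (k : ℕ)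
    (hg : ∀ F ⊆ Finset.range k, F.Nonempty → g (insert k F) = g F) :
    ∑ F ∈ (Finset.range (k + 1)).powerset, (-1 : ℤ) ^ F.card * g F = g ∅ - g {k} := by
  rw [Finset.range_add_one, Finset.sum_powerset_insert Finset.notMem_range_self,
    ← Finset.sum_add_distrib, Finset.sum_eq_single ∅]
  · simp [sub_eq_add_neg]
  · intro F hF hne
    have hF' := Finset.mem_powerset.1 hF
    rw [Finset.card_insert_of_notMem fun h ↦ Finset.notMem_range_self (hF' h),
      hg F hF' (Finset.nonempty_iff_ne_empty.2 hne)]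
    ring
  · simp

/-- The Mason–Ingleton inequality for a sequence of sets satisfying rank conditions that
MI-orderings guarantee. -/
theorem Matroid.intRank_biInter_le_of_ordering (M : Matroid α) [M.RankFinite] (b : ℕ → Set α)
    (hE : ∀ i, b i ⊆ M.E) (t : ℕ)
    (hsup : ∀ i j k, i ≤ j → j ≤ k → k < t → b j ⊆ M.closure (b i ∪ b k))
    (hinf : ∀ k, k + 1 < t → b k ⊆ M.closure ((⋂ i ∈ Finset.range (k + 1), b i) ∪ b (k + 1)))
    (ht : 0 < t) :
    M.intRank (⋂ i ∈ Finset.range t, b i) ≤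
      ∑ F ∈ (Finset.range t).powerset, (-1 : ℤ) ^ (F.card + 1) * M.intRank (⋃ i ∈ F, b i) := by
  induction t, Nat.succ_le_iff.2 ht using Nat.le_induction with
  | base =>
    rw [Finset.range_one, show ({0} : Finset ℕ) = insert 0 ∅ from rfl,
      Finset.sum_powerset_insert (by simp)]
    simp [Matroid.intRank_empty]
  | succ t h1 ih =>
    obtain ⟨k, rfl⟩ : ∃ k, t = k + 1 := ⟨t - 1, by omega⟩
    have ih' := ih (fun i j l hij hjl hl ↦ hsup i j l hij hjl (by omega))
      (fun l hl ↦ hinf l (by omega)) (by omega)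
    have hg := Finset.sum_powerset_range_alternating
      (fun F ↦ M.intRank (⋃ i ∈ insert (k + 1) F, b i)) k (fun F hF hne ↦ by
        obtain ⟨i, hi⟩ := hne
        have hcl : M.closure (⋃ i ∈ insert (k + 1) (insert k F), b i) =
            M.closure (⋃ i ∈ insert (k + 1) F, b i) := by
          have hF := Finset.mem_range.1 (hF hi)
          refine Subset.antisymm (M.closure_subset_closure_of_subset_closure ?_)
            (M.closure_subset_closure (biUnion_subset_biUnion_left fun j hj ↦ ?_))
          · refine iUnion₂_subset fun j hj ↦ ?_
            rcases eq_or_ne j k with rfl | hjk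
            · refine (hsup i j (j + 1) hF.le (by omega) (by omega)).trans
                (M.closure_subset_closure (union_subset ?_ ?_))
              · exact subset_biUnion_of_mem (u := b) (Finset.mem_insert_of_mem hi)
              · exact subset_biUnion_of_mem (u := b) (Finset.mem_insert_self _ _)
            · refine (M.subset_closure _ (hE j)).trans (M.closure_subset_closure
                (subset_biUnion_of_mem (u := b) (?_ : j ∈ insert (k + 1) F)))
              simpa [hjk] using hj
          · exact Finset.insert_subset_insert _ (Finset.subset_insert _ _) hj
        rw [← M.intRank_closure, hcl, M.intRank_closure])
    have hsum : ∑ F ∈ (Finset.range (k + 1 + 1)).powerset,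
        (-1 : ℤ) ^ (F.card + 1) * M.intRank (⋃ i ∈ F, b i) =
        ∑ F ∈ (Finset.range (k + 1)).powerset,
          (-1 : ℤ) ^ (F.card + 1) * M.intRank (⋃ i ∈ F, b i) +
        (M.intRank (b (k + 1)) - M.intRank (b k ∪ b (k + 1))) := by
      rw [Finset.range_add_one, Finset.sum_powerset_insert Finset.notMem_range_self]
      congr 1
      have hg' : M.intRank (b (k + 1)) - M.intRank (b k ∪ b (k + 1)) =
          ∑ F ∈ (Finset.range (k + 1)).powerset,
            (-1 : ℤ) ^ F.card * M.intRank (⋃ i ∈ insert (k + 1) F, b i) := by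
        rw [hg]
        simp [union_comm]
      rw [hg']
      refine Finset.sum_congr rfl fun F hF ↦ ?_
      rw [Finset.card_insert_of_notMem fun h ↦
        Finset.notMem_range_self (Finset.mem_powerset.1 hF h)]
      ring
    -- Submodularity for the old intersection and the new set, combined with (b), pays exactly for
    -- the two surviving terms.
    have hsub := M.intRank_inter_add_intRank_union_le (⋂ i ∈ Finset.range (k + 1), b i) (b (k + 1))
    have hcl : M.intRank (b k ∪ b (k + 1)) ≤
        M.intRank ((⋂ i ∈ Finset.range (k + 1), b i) ∪ b (k + 1)) := by
      rw [← M.intRank_closure ((⋂ i ∈ Finset.range (k + 1), b i) ∪ b (k + 1))]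
      exact M.intRank_mono (union_subset (hinf k (by omega))
        (subset_union_right.trans (M.subset_closure _
          (union_subset ((biInter_subset_of_mem (by simp)).trans (hE k)) (hE (k + 1))))))
    rw [hsum, Finset.range_add_one, Finset.set_biInter_insert, inter_comm]
    linarith

end IntRank

/-! ### Sufficiency of the Mason–Ingleton inequalities -/

/-- Möbius inversion: a function on a finite partial order is the sum over the elements above of
some function. -/
theorem exists_sum_ge_eq {P : Type*} [PartialOrder P] [Fintype P] [DecidableLE P] (f : P → ℤ) :
    ∃ β : P → ℤ, ∀ x, ∑ y with x ≤ y, β y = f x := by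
  classical
  -- The recursion runs downwards: `β x` is determined by its values strictly above `x`.
  let β : P → ℤ := (wellFounded_gt (α := P)).fix fun x ih ↦
    f x - ∑ y ∈ (Finset.univ.filter (x < ·)).attach, ih y.1 (Finset.mem_filter.1 y.2).2
  have hβ : ∀ x, β x = f x - ∑ y with x < y, β y := fun x ↦ by
    rw [← Finset.sum_attach]
    exact WellFounded.fix_eq _ _ x
  refine ⟨β, fun x ↦ ?_⟩
  have : Finset.univ.filter (x ≤ ·) = insert x (Finset.univ.filter (x < ·)) := by
    ext y
    simp [le_iff_eq_or_lt, eq_comm]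
  rw [this, Finset.sum_insert (by simp), hβ]
  ring

section Beta

variable {α : Type u} {M : Matroid α} [Fintype M.CyclicFlats]

open scoped Classical in
/-- If `β` sums to coranks over the principal filters of `𝒵(M)`, the Mason–Ingleton inequality
bounds its sums over arbitrary filters. -/
theorem Matroid.sum_filter_le_corank [M.RankFinite]
    (hMI : ∀ A : Finset M.CyclicFlats, A.Nonempty → IsAntichain (· ≤ ·) (A : Set M.CyclicFlats) →
      M.SatisfiesMI A) {β : M.CyclicFlats → ℤ}
    (hβ : ∀ X : M.CyclicFlats, ∑ Y with X ≤ Y, β Y = M.intRank M.E - M.intRank (X : Set α))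
    {U : Finset M.CyclicFlats} (hU : IsUpperSet (U : Set M.CyclicFlats)) {J : Set α}
    (hJ : ∀ Y ∈ U, J ⊆ (Y : Set α)) :
    ∑ Y ∈ U, β Y ≤ M.intRank M.E - M.intRank J := by
  rcases U.eq_empty_or_nonempty with rfl | hne
  · simpa using M.intRank_le_ground J
  let A := U.filter fun X ↦ Minimal (· ∈ U) X
  have hAU : ∀ X ∈ A, X ∈ U := fun X hX ↦ (Finset.mem_filter.1 hX).1
  have hexists : ∀ Y ∈ U, ∃ X ∈ A, X ≤ Y := fun Y hY ↦ by
    obtain ⟨X, hXY, hX⟩ := U.exists_le_minimal hY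
    exact ⟨X, Finset.mem_filter.2 ⟨hX.prop, hX⟩, hXY⟩
  have hA : IsAntichain (· ≤ ·) (A : Set M.CyclicFlats) := fun X hX Y hY hXY hle ↦
    hXY ((Finset.mem_filter.1 hY).2.eq_of_le (hAU X hX) hle)
  have hAne : A.Nonempty := by
    obtain ⟨Y, hY⟩ := hne
    obtain ⟨X, hX, -⟩ := hexists Y hY
    exact ⟨X, hX⟩
  have hJA : J ⊆ ⋂ X ∈ A, (X : Set α) := subset_iInter₂ fun X hX ↦ hJ X (hAU X hX)
  -- The filter `U` is the union of the principal filters of its minimal elements, so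
  -- inclusion–exclusion can run over the antichain `A`.
  have hcompl : (A.inf fun X ↦ (Finset.univ.filter (X ≤ ·))ᶜ) = Uᶜ := by
    ext Y
    simp only [Finset.mem_inf, Finset.mem_compl, Finset.mem_filter, Finset.mem_univ, true_and]
    refine ⟨fun h hY ↦ ?_, fun h X hX hXY ↦ h (hU hXY (hAU X hX))⟩
    obtain ⟨X, hX, hXY⟩ := hexists Y hY
    exact h X hX hXY
  -- Principal filters intersect in the principal filter of the join, whose rank is that of the
  -- union.
  have hinter : ∀ F : Finset M.CyclicFlats,
      ∑ Y ∈ F.inf fun X ↦ Finset.univ.filter (X ≤ ·), β Y =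
        M.intRank M.E - M.intRank (⋃ X ∈ F, (X : Set α)) := fun F ↦ by
    rw [← M.intRank_closure (⋃ X ∈ F, (X : Set α)), ← hβ ⟨_, Matroid.isCyclicFlat_closure_biUnion F⟩]
    refine Finset.sum_congr ?_ fun _ _ ↦ rfl
    ext Y
    simp only [Finset.mem_inf, Finset.mem_filter, Finset.mem_univ, true_and]
    rw [← Subtype.coe_le_coe, Y.2.1.closure_subset_iff_subset
      (Matroid.biUnion_cyclicFlats_subset_ground F), iUnion₂_subset_iff]
    rfl
  have htotal : ∑ Y, β Y = M.intRank M.E := by simpa [Matroid.intRank_empty] using hinter ∅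
  have hIE := Finset.inclusion_exclusion_sum_inf_compl A
    (fun X ↦ Finset.univ.filter (X ≤ ·)) β
  have hsplit := Finset.sum_add_sum_compl U β
  rw [hcompl] at hIE
  have hmi := hMI A hAne hA
  have hcalc : ∑ F ∈ A.powerset, (-1 : ℤ) ^ F.card •
      ∑ Y ∈ F.inf fun X ↦ Finset.univ.filter (X ≤ ·), β Y =
      ∑ F ∈ A.powerset, (-1 : ℤ) ^ (F.card + 1) * M.intRank (⋃ X ∈ F, (X : Set α)) := by
    -- The constant `r(M)` cancels because `A` is nonempty.
    have h0 := Finset.sum_powerset_neg_one_pow_card_of_nonempty hAne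
    calc _ = (∑ F ∈ A.powerset, (-1 : ℤ) ^ F.card) * M.intRank M.E +
        ∑ F ∈ A.powerset, (-1 : ℤ) ^ (F.card + 1) * M.intRank (⋃ X ∈ F, (X : Set α)) := by
          rw [Finset.sum_mul, ← Finset.sum_add_distrib]
          refine Finset.sum_congr rfl fun F _ ↦ ?_
          rw [hinter, smul_eq_mul]
          ring
      _ = _ := by rw [h0, zero_mul, zero_add]
  rw [hcalc] at hIE
  unfold Matroid.SatisfiesMI at hmi
  have := M.intRank_mono hJA
  linarith

end Beta

/-- The sufficiency half of the Mason–Ingleton theorem. -/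
theorem Matroid.isTransversal_of_satisfiesMI {α : Type u} {M : Matroid α} [hM : M.Finite]
    (hMI : ∀ A : Finset M.CyclicFlats, A.Nonempty → IsAntichain (· ≤ ·) (A : Set M.CyclicFlats) →
      M.SatisfiesMI A) : M.IsTransversal := by
  classical
  have hfin : {F : Set α | M.IsCyclicFlat F}.Finite :=
    M.ground_finite.finite_subsets.subset fun F hF ↦ hF.1.subset_ground
  have : Fintype M.CyclicFlats := hfin.fintype
  obtain ⟨β, hβ⟩ := exists_sum_ge_eq
    fun X : M.CyclicFlats ↦ M.intRank M.E - M.intRank (X : Set α)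
  have hle : ∀ J : Set α, ∑ Y : M.CyclicFlats with J ⊆ Y.1, β Y ≤
      M.intRank M.E - M.intRank J := fun J ↦
    Matroid.sum_filter_le_corank hMI hβ
      (fun X Y hXY hX ↦ by
        simp only [Finset.coe_filter, Finset.mem_univ, true_and, mem_ofPred_eq] at hX ⊢
        exact hX.trans hXY)
      (fun Y hY ↦ (Finset.mem_filter.1 hY).2)
  have hnonneg : ∀ X, 0 ≤ β X := fun X ↦ by
    -- The flats strictly above `X` contribute at most the corank of `X`; those weakly above
    -- contribute exactly that, and the difference is `β X`.
    have h := Matroid.sum_filter_le_corank hMI hβ (U := Finset.univ.filter (X < ·)) (J := X.1)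
      (fun Y Z hYZ hY ↦ by
        simp only [Finset.coe_filter, Finset.mem_univ, true_and, mem_ofPred_eq] at hY ⊢
        exact hY.trans_le hYZ)
      (fun Y hY ↦ (Finset.mem_filter.1 hY).2.le)
    have hX := hβ X
    have : Finset.univ.filter (X ≤ ·) = insert X (Finset.univ.filter (X < ·)) := by
      ext y
      simp [le_iff_eq_or_lt, eq_comm]
    rw [this, Finset.sum_insert (by simp)] at hX
    linarith
  have htotal : ∑ Y, β Y = M.intRank M.E := by
    -- The closure of `∅` is the least cyclic flat and has rank zero.
    have h := hβ ⟨_, Matroid.isCyclicFlat_closure_biUnion ∅⟩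
    rw [Finset.filter_true_of_mem fun Y _ ↦ ?_] at h
    · rw [h]
      simp [Matroid.intRank_closure, Matroid.intRank_empty]
    · rw [← Subtype.coe_le_coe, Y.2.1.closure_subset_iff_subset
        (Matroid.biUnion_cyclicFlats_subset_ground ∅)]
      simp
  -- the number of members of the presentation that meet `J`
  let ι := Σ Y : M.CyclicFlats, Fin (β Y).toNat
  have hcard : ∀ J : Set α, ((Finset.univ.filter fun i : ι ↦ ¬ J ⊆ i.1.1).card : ℤ) =
      M.intRank M.E - ∑ Y : M.CyclicFlats with J ⊆ Y.1, β Y := fun J ↦ by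
    have h1 : Finset.univ.filter (fun i : ι ↦ ¬ J ⊆ i.1.1) =
        (Finset.univ.filter fun Y : M.CyclicFlats ↦ ¬ J ⊆ Y.1).sigma fun _ ↦ Finset.univ := by
      ext i
      rw [Finset.mem_sigma]
      simp
    rw [h1, Finset.card_sigma, ← htotal, ← Finset.sum_filter_add_sum_filter_not Finset.univ
      (fun Y : M.CyclicFlats ↦ J ⊆ Y.1), add_sub_cancel_left]
    push_cast
    refine Finset.sum_congr rfl fun Y _ ↦ ?_
    simp [hnonneg Y]
  refine Matroid.IsTransversal.of_fintype (ι := ι) (fun i ↦ M.E \ i.1.1)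
    (fun i ↦ sdiff_subset) fun I ↦ ⟨fun hI ↦ ?_, ?_⟩
  · let T : I → Finset ι := fun e ↦ Finset.univ.filter fun i ↦ (e : α) ∈ M.E \ i.1.1
    obtain ⟨f, hf, hfT⟩ := (Finset.all_card_le_biUnion_card_iff_exists_injective T).1 fun s ↦ by
      let J : Finset α := s.map (Function.Embedding.subtype _)
      have hJI : (J : Set α) ⊆ I := by
        intro x hx
        simp only [J, Finset.coe_map, mem_image] at hx
        obtain ⟨y, -, rfl⟩ := hx
        exact y.2
      have hT : s.biUnion T = Finset.univ.filter fun i : ι ↦ ¬ (J : Set α) ⊆ i.1.1 := by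
        ext i
        simp only [T, J, Finset.mem_biUnion, Finset.mem_filter, Finset.mem_univ, true_and,
          Set.not_subset, Finset.coe_map, mem_image]
        constructor
        · rintro ⟨e, he, -, hei⟩
          exact ⟨e, ⟨e, he, rfl⟩, hei⟩
        · rintro ⟨-, ⟨e, he, rfl⟩, hei⟩
          exact ⟨e, he, hI.subset_ground e.2, hei⟩
      have h1 := hcard J
      have h2 := hle J
      rw [(hI.subset hJI).intRank_eq, Finset.card_map] at h2
      rw [hT]
      rw [← Int.ofNat_le]
      linarith
    exact ⟨f, hf, fun e ↦ (Finset.mem_filter.1 (hfT e)).2⟩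
  · rintro ⟨f, hf, hfS⟩
    by_contra hI
    obtain ⟨C, hCI, hC⟩ := ((Matroid.not_indep_iff fun e he ↦ (hfS ⟨e, he⟩).1).1
      hI).exists_isCircuit_subset
    obtain ⟨C, rfl⟩ : ∃ C' : Finset α, C = C' :=
      ⟨(M.ground_finite.subset hC.subset_ground).toFinset, by simp⟩
    -- For a circuit the filter bound is an equality, as its closure is a cyclic flat. Exactly `r(C)
    -- = |C| - 1` members meet `C`, too few for an injection.
    have hcl : M.IsCyclicFlat (M.closure C) :=
      Matroid.isCyclicFlat_closure fun e he ↦ hC.mem_closure_sdiff_singleton_of_mem he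
    have h1 := hβ ⟨_, hcl⟩
    have h2 : Finset.univ.filter (fun Y : M.CyclicFlats ↦ (⟨_, hcl⟩ : M.CyclicFlats) ≤ Y) =
        Finset.univ.filter fun Y ↦ (C : Set α) ⊆ Y.1 := by
      refine Finset.filter_congr fun Y _ ↦ ?_
      rw [← Subtype.coe_le_coe, Y.2.1.closure_subset_iff_subset hC.subset_ground]
    rw [h2, M.intRank_closure] at h1
    have h3 := hcard C
    have h4 := hC.intRank_add_one
    have h5 : C.card ≤ (Finset.univ.filter fun i : ι ↦ ¬ (C : Set α) ⊆ i.1.1).card := by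
      rw [← Finset.card_attach]
      refine Finset.card_le_card_of_injOn (fun e : C ↦ f ⟨e, hCI e.2⟩) ?_ ?_
      · intro e _
        simp only [Finset.coe_filter, Finset.mem_univ, true_and, mem_ofPred_eq]
        exact fun h ↦ (hfS ⟨e, hCI e.2⟩).2 (h e.2)
      · intro e _ e' _ h
        exact Subtype.ext (congrArg (fun x : I ↦ (x : α)) (hf h))
    have h6 : (C.card : ℤ) ≤ _ := Int.ofNat_le.2 h5
    linarith

/-! ### The main theorem -/

theorem Matroid.satisfiesMI_of_isMIOrderable {α : Type u} {M : Matroid α} [M.RankFinite]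
    {A : Finset M.CyclicFlats} (hne : A.Nonempty) (hA : IsMIOrderable A) : M.SatisfiesMI A := by
  classical
  obtain ⟨t, a, hinj, hrange, ha⟩ := hA
  have hbase : Nonempty M.CyclicFlats := ⟨hne.choose⟩
  -- The value past `t` is arbitrary; only indices below `t` are used.
  let b : ℕ → M.CyclicFlats := fun i ↦ if h : i < t then a ⟨i, h⟩ else hbase.some
  have hb : ∀ i (h : i < t), b i = a ⟨i, h⟩ := fun i h ↦ dif_pos h
  have hbinj : Set.InjOn b (Finset.range t) := by
    intro i hi j hj hij
    rw [Finset.mem_coe, Finset.mem_range] at hi hj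
    rw [hb i hi, hb j hj] at hij
    exact congrArg Fin.val (hinj hij)
  have hAb : A = (Finset.range t).image b := by
    ext X
    rw [← Finset.mem_coe, ← hrange, Finset.mem_image]
    constructor
    · rintro ⟨i, rfl⟩
      exact ⟨i, Finset.mem_range.2 i.2, hb i i.2⟩
    · rintro ⟨i, hi, rfl⟩
      exact ⟨⟨i, Finset.mem_range.1 hi⟩, (hb i _).symm⟩
  have ht : 0 < t := by
    rw [hAb, Finset.image_nonempty, Finset.nonempty_range_iff] at hne
    omega
  rw [isMIOrdering_iff] at ha
  have hmain := M.intRank_biInter_le_of_ordering (fun i ↦ (b i : Set α))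
    (fun i ↦ (b i).2.1.subset_ground) t
    (fun i j k hij hjk hk ↦ by
      rw [hb i (by omega), hb j (by omega), hb k hk]
      exact ha.1 _ _ _ hij hjk)
    (fun k hk ↦ by
      -- Condition (b) omits the first index, where the inclusion is trivial.
      rcases Nat.eq_zero_or_pos k with rfl | hk0
      · refine (M.subset_closure _ (b 0).2.1.subset_ground).trans
          (M.closure_subset_closure ?_)
        simp
      · rw [hb k (by omega), hb (k + 1) hk]
        have h := ha.2 ⟨k, by omega⟩ ⟨k + 1, hk⟩ hk0 rfl
        -- The meet in `𝒵(M)` may be smaller than the intersection, but containment is all that is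
        -- needed.
        refine Subset.trans (show (a ⟨k, by omega⟩).1 ⊆ _ from h)
          (M.closure_subset_closure (union_subset_union_left _ (subset_iInter₂ fun i hi ↦ ?_)))
        have hi' := Finset.mem_range.1 hi
        rw [hb i (by omega)]
        exact Finset.inf'_le a (Finset.mem_Iic.2 (Nat.lt_succ_iff.1 hi')))
    ht
  unfold Matroid.SatisfiesMI
  rw [hAb, Finset.powerset_image, Finset.sum_image (Finset.image_injOn_powerset_of_injOn hbinj)]
  rw [Finset.set_biInter_finset_image]
  refine hmain.trans_eq (Finset.sum_congr rfl fun F hF ↦ ?_)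
  rw [Finset.card_image_of_injOn
    (hbinj.mono (Finset.coe_subset.2 (Finset.mem_powerset.1 hF))), Finset.set_biUnion_finset_image]

theorem Matroid.isTransversal_of_isMILattice {α : Type u} {M : Matroid α} [M.Finite]
    (h : IsMILattice M.CyclicFlats) : M.IsTransversal :=
  Matroid.isTransversal_of_satisfiesMI fun A hne hA ↦
    Matroid.satisfiesMI_of_isMIOrderable hne (h A hA)

theorem mainTheorem1 :
    (∀ (α : Type u) (M : Matroid α), M.Finite →
      (∀ A : Finset M.CyclicFlats, A.Nonempty → IsAntichain (· ≤ ·) (A : Set M.CyclicFlats) →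
        IsMIOrderable A → M.SatisfiesMI A) ∧
      (IsMILattice M.CyclicFlats →
        M.IsTransversal ∧ ∀ N : Matroid α, N.IsMinor M → N.IsTransversal)) ∧
    (∀ (L : Type v) [Lattice L] [Finite L], IsMILattice L → IsTrLattice.{u, v} L) := by
  refine ⟨fun α M hM ↦ ⟨fun A hne _ hA ↦ Matroid.satisfiesMI_of_isMIOrderable hne hA, fun h ↦
    ⟨Matroid.isTransversal_of_isMILattice h, fun N hN ↦ ?_⟩⟩, fun L _ _ hL α M hM ⟨e⟩ ↦
    Matroid.isTransversal_of_isMILattice (hL.of_galoisInsertion e.symm.toGaloisInsertion)⟩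
  obtain ⟨C, D, hC, -, -, rfl⟩ := hN.exists_eq_contract_delete_disjoint
  exact (Matroid.isTransversal_of_isMILattice
    (h.of_galoisInsertion (M.contractGaloisInsertion hC))).delete D
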